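/- A Banach limit on $(0,\infty)$ is a positive continuous linear functional $\omega$ on $L^\infty(0,\infty)$ with $\omega(f)=\operatorname{ess\,lim}_{t\to+\infty}f(t)$ whenever this limit exists. Let $\omega$ be a Banach limit on $(0,\infty)$ which is invariant under the dilation $f\mapsto f(\cdot/2)$ and under the power dilations $f\mapsto f((\cdot)^\alpha)$ for all $\alpha>1$. We write $\omega\text{-}\lim_{t\to+\infty}f(t)$ for $\omega(f)$; this makes sense for every function $f$ that agrees a.e. on some $(T,\infty)$ with an element of $L^\infty(0,\infty)$, because $\omega(f)$ depends only on the behaviour of $f$ near $+\infty$. We write $\tilde\omega\text{-}\lim_{r\to+\infty}f(r)$ for $\omega\text{-}\lim_{t\to+\infty}f(\log t)$. Let $H$ be a nonincreasing real function on $(0,\infty)$, not identically zero, which belongs to $L^p(0,\infty)$ for all $p\in(1,p_0)$ with some $p_0>1$. Then $H$ is integrable on $(0,t)$ for every $t>0$, and $\{t>0:H(t)>\lambda\}$ is bounded for every $\lambda>0$. Let $$\mu_H(\lambda):=\sup\{t>0:H(t)>\lambda\}\ \ (\sup\emptyset:=0),\qquad c_H:=\sup_{t>2}\frac1{\log t}\int_0^tH(s)\,ds\in[0,+\infty].$$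 (a) For any real $c>c_H$ there exists $t_c\in(0,\infty)$ such that $\mu_H(1/t)\le c\,t\log t$ for all $t\ge t_c$. (b) For any real $c>c_H$ the following $\omega$-limits are defined, and $$\omega\text{-}\lim_{t\to+\infty}\frac1{\log t}\int_0^tH(s)\,ds=\omega\text{-}\lim_{t\to+\infty}\frac1{\log t}\int_0^{ct\log t}H(s)\,ds=\omega\text{-}\lim_{t\to+\infty}\frac1{\log t}\int_0^{\mu_H(1/t)}H(s)\,ds.$$ (c) $$\tilde\omega\text{-}\lim_{r\to+\infty}\frac1r\int_0^\infty H(s)^{1+\frac1r}\,ds=\omega\text{-}\lim_{t\to+\infty}\frac1{\log t}\int_0^tH(s)\,ds,$$ in the sense that one side is defined if and only if the other is, and then they are equal; both are defined if $c_H<\infty$. -/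

import Mathlib

open MeasureTheory Filter Topology Set
open scoped ENNReal

noncomputable section

/-- Lebesgue measure on the half-line `(0, ∞)`. -/
abbrev halfLine : Measure ℝ := volume.restrict (Ioi (0 : ℝ))

/-- The (real) space `L^∞(0, ∞)`. -/
abbrev LInfty : Type := Lp ℝ ∞ halfLine

/-- A Banach limit on `(0, ∞)`: a positive continuous linear functional on `L^∞(0, ∞)` which
coincides with the essential limit at `+∞` whenever the latter exists. Convergence along
`ae halfLine ⊓ atTop` is exactly existence of the essential limit: for every `ε > 0` there is
`T` with `|f t - a| < ε` for almost every `t > T`. -/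
structure IsBanachLimit (ω : LInfty →L[ℝ] ℝ) : Prop where
  nonneg : ∀ f : LInfty, (∀ᵐ t ∂halfLine, 0 ≤ f t) → 0 ≤ ω f
  eq_essLim : ∀ (f : LInfty) (a : ℝ), Tendsto f (ae halfLine ⊓ atTop) (𝓝 a) → ω f = a

/-- Invariance `ω ∘ D_a = ω` under the dilation `D_a f (x) = f (x / a)`, for `a > 0`. -/
def IsDilationInvariant (ω : LInfty →L[ℝ] ℝ) (a : ℝ) : Prop :=
  ∀ f g : LInfty, (∀ᵐ x ∂halfLine, g x = f (x / a)) → ω g = ω f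

/-- Invariance `ω ∘ P_α = ω` under the power dilation `P_α f (x) = f (x ^ α)`, for `α > 0`. -/
def IsPowerInvariant (ω : LInfty →L[ℝ] ℝ) (α : ℝ) : Prop :=
  ∀ f g : LInfty, (∀ᵐ x ∂halfLine, g x = f (x ^ α)) → ω g = ω f

/-- `ω-lim_{t → +∞} f(t) = L`. The function `f` may be arbitrary for small `t`: it is required
to agree, almost everywhere near `+∞`, with an element of `L^∞(0, ∞)` on which `ω` takes the
value `L`. The value `L` does not depend on the choice of that element
(see `HasOmegaLim.unique`). -/
def HasOmegaLim (ω : LInfty →L[ℝ] ℝ) (f : ℝ → ℝ) (L : ℝ) : Prop :=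
  ∃ g : LInfty, (∃ T : ℝ, ∀ᵐ t ∂halfLine, T < t → g t = f t) ∧ ω g = L

/-- `ω̃-lim_{r → +∞} f(r) = L`, where `ω̃` is the Banach limit on `ℝ` corresponding to `ω`,
that is, `ω̃(f) = ω(f ∘ log)`. -/
def HasOmegaTildeLim (ω : LInfty →L[ℝ] ℝ) (f : ℝ → ℝ) (L : ℝ) : Prop :=
  HasOmegaLim ω (fun t => f (Real.log t)) L

theorem HasOmegaLim.unique {ω : LInfty →L[ℝ] ℝ} (hω : IsBanachLimit ω) {f : ℝ → ℝ} {L L' : ℝ}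
    (h : HasOmegaLim ω f L) (h' : HasOmegaLim ω f L') : L = L' := by
  obtain ⟨g, ⟨T, hg⟩, rfl⟩ := h
  obtain ⟨g', ⟨T', hg'⟩, rfl⟩ := h'
  have key : ω (g - g') = 0 := by
    refine hω.eq_essLim _ 0 (tendsto_const_nhds.congr' ?_)
    have h1 : ∀ᵐ t ∂halfLine, max T T' < t → (g - g' : LInfty) t = 0 := by
      filter_upwards [hg, hg', Lp.coeFn_sub g g'] with t h1 h2 h3 ht
      rw [h3, Pi.sub_apply, h1 (lt_of_le_of_lt (le_max_left _ _) ht),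
        h2 (lt_of_le_of_lt (le_max_right _ _) ht), sub_self]
    have h2 : ∀ᶠ t in ae halfLine ⊓ atTop, max T T' < t → (g - g' : LInfty) t = 0 :=
      h1.filter_mono inf_le_left
    have h3 : ∀ᶠ t in ae halfLine ⊓ atTop, max T T' < t :=
      (eventually_gt_atTop (max T T')).filter_mono inf_le_right
    filter_upwards [h2, h3] with t h2 h3
    exact (h2 h3).symm
  rw [map_sub] at key
  exact sub_eq_zero.mp key

/-- The distribution function `μ_H(l) = sup {t > 0 : H(t) > l}`; it is `0` if the set
is empty. -/
def distFun (H : ℝ → ℝ) (l : ℝ) : ℝ := sSup {t : ℝ | 0 < t ∧ l < H t}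

/-- `c_H = sup_{t > 2} (1 / log t) ∫_0^t H(s) ds`, possibly `+∞`. -/
def cSup (H : ℝ → ℝ) : EReal :=
  ⨆ t ∈ Ioi (2 : ℝ), ((1 / Real.log t * ∫ s in Ioc 0 t, H s : ℝ) : EReal)

end

/-! Everything rests on log(t^α) = α log t: invariance of ω under t ↦ t^α implies that if J(t)/log t
has ω-limit L, then J(t^α)/log t has ω-limit αL (`hasOmegaLim_rpow`).

For (a), if H exceeds 1/t somewhere beyond s = ct log t, then H > 1/t on (0, s] and ∫_0^s H ≥ c log
t. But this integral is at most c' log s with c' < c, while log s ~ log t. For (b), H ≤ 1/t off {H >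
1/t}, so ∫_0^t H exceeds the integral over {H > 1/t} by at most 1; by (a) the latter is at most
∫_0^{ct log t} H, eventually at most ∫_0^{t^α} H. All three limits lie between L and αL for every α
> 1.

For (c), put r = log t and cut {H ≤ 1} into shells e^{-(k+1)dr} < H ≤ e^{-kdr}. On such a shell
H^{1/r} lies between e^{-(k+1)d} and e^{-kd}, and the integral of H over it, divided by r, has
ω-limit dL. Geometric series then squeeze the left side A between dL e^{-d}/(1-e^{-d}) and
dL/(1-e^{-d}), and d → 0 gives A = L (`omegaLim_rpow_bounds`, `omegaLim_rpow_eq`). As ω is only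
finitely additive, the part below the first K shells is bounded separately, by e^{-Kd/2} ∫
H^{1+1/(2r)}, whose ω-average is 2A e^{-Kd/2}. Conversely, if either side is defined, it is
essentially bounded, and monotonicity of t ↦ ∫_0^t H turns this into c_H < ∞. -/

section OmegaLim

/-! ### Calculus of generalized limits. -/

variable {ω : LInfty →L[ℝ] ℝ} {f g : ℝ → ℝ} {L L' : ℝ}

theorem HasOmegaLim.congr (h : HasOmegaLim ω f L) (hfg : ∀ᶠ t in atTop, f t = g t) :
    HasOmegaLim ω g L := by
  obtain ⟨u, ⟨T, hu⟩, hL⟩ := h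
  obtain ⟨S, hS⟩ := eventually_atTop.mp hfg
  refine ⟨u, ⟨max T S, ?_⟩, hL⟩
  filter_upwards [hu] with t ht hlt
  rw [ht ((le_max_left _ _).trans_lt hlt), hS t ((le_max_right _ _).trans hlt.le)]

theorem HasOmegaLim.add (hf : HasOmegaLim ω f L) (hg : HasOmegaLim ω g L') :
    HasOmegaLim ω (fun t => f t + g t) (L + L') := by
  obtain ⟨u, ⟨T, hu⟩, rfl⟩ := hf
  obtain ⟨v, ⟨S, hv⟩, rfl⟩ := hg
  refine ⟨u + v, ⟨max T S, ?_⟩, map_add _ _ _⟩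
  filter_upwards [hu, hv, Lp.coeFn_add u v] with t h1 h2 h3 hlt
  rw [h3, Pi.add_apply, h1 ((le_max_left _ _).trans_lt hlt), h2 ((le_max_right _ _).trans_lt hlt)]

theorem HasOmegaLim.const_mul (c : ℝ) (hf : HasOmegaLim ω f L) :
    HasOmegaLim ω (fun t => c * f t) (c * L) := by
  obtain ⟨u, ⟨T, hu⟩, rfl⟩ := hf
  refine ⟨c • u, ⟨T, ?_⟩, by simp⟩
  filter_upwards [hu, Lp.coeFn_smul c u] with t h1 h3 hlt
  rw [h3, Pi.smul_apply, h1 hlt, smul_eq_mul]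

theorem HasOmegaLim.sub (hf : HasOmegaLim ω f L) (hg : HasOmegaLim ω g L') :
    HasOmegaLim ω (fun t => f t - g t) (L - L') := by
  convert hf.add (hg.const_mul (-1)) using 2 <;> ring

theorem hasOmegaLim_zero : HasOmegaLim ω (fun _ => 0) 0 := by
  refine ⟨0, ⟨0, ?_⟩, map_zero _⟩
  filter_upwards [Lp.coeFn_zero ℝ ∞ halfLine] with t ht _
  rw [ht, Pi.zero_apply]

theorem HasOmegaLim.sum {F : ℕ → ℝ → ℝ} {l : ℕ → ℝ} (h : ∀ k, HasOmegaLim ω (F k) (l k)) (K : ℕ) :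
    HasOmegaLim ω (fun t => ∑ k ∈ Finset.range K, F k t) (∑ k ∈ Finset.range K, l k) := by
  induction K with
  | zero => simpa using hasOmegaLim_zero
  | succ K ih => simpa only [Finset.sum_range_succ] using ih.add (h K)

theorem exists_hasOmegaLim (hf : AEMeasurable f halfLine) {C : ℝ}
    (hb : ∀ᶠ t in atTop, |f t| ≤ C) : ∃ L, HasOmegaLim ω f L := by
  obtain ⟨T, hT⟩ := eventually_atTop.mp hb
  have hC : 0 ≤ C := (abs_nonneg _).trans (hT T le_rfl)
  have hmem : MemLp ((Ioi T).indicator f) ∞ halfLine := by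
    refine memLp_top_of_bound (hf.indicator measurableSet_Ioi).aestronglyMeasurable C ?_
    refine Eventually.of_forall fun t => ?_
    by_cases ht : t ∈ Ioi T
    · rw [indicator_of_mem ht]
      exact hT t (le_of_lt ht)
    · rw [indicator_of_notMem ht]
      simpa using hC
  refine ⟨_, hmem.toLp _, ⟨T, ?_⟩, rfl⟩
  filter_upwards [hmem.coeFn_toLp] with t ht hlt
  rw [ht, indicator_of_mem (show t ∈ Ioi T from hlt)]

/-- Positivity of ω needs a representative that is nonnegative on the whole half-line. If u
represents f, then |u| is one, and it agrees with u near +∞, where alone ω looks. -/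
theorem HasOmegaLim.nonneg (hω : IsBanachLimit ω) (h : HasOmegaLim ω f L)
    (hf : ∀ᶠ t in atTop, 0 ≤ f t) : 0 ≤ L := by
  obtain ⟨u, ⟨T, hu⟩, rfl⟩ := h
  obtain ⟨S, hS⟩ := eventually_atTop.mp hf
  have hmem : MemLp (fun t => |u t|) ∞ halfLine := (Lp.memLp u).abs
  have h1 : ω (hmem.toLp _ - u) = 0 := by
    refine hω.eq_essLim _ 0 (tendsto_const_nhds.congr' ?_)
    have h2 : ∀ᵐ t ∂halfLine, max T S < t → (hmem.toLp _ - u : LInfty) t = 0 := by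
      filter_upwards [hu, hmem.coeFn_toLp, Lp.coeFn_sub (hmem.toLp _) u] with t h1 h2 h3 hlt
      have h4 := hS t ((le_max_right _ _).trans hlt.le)
      rw [← h1 ((le_max_left _ _).trans_lt hlt)] at h4
      rw [h3, Pi.sub_apply, h2, abs_of_nonneg h4, sub_self]
    filter_upwards [h2.filter_mono inf_le_left,
      (eventually_gt_atTop (max T S)).filter_mono inf_le_right] with t h2 h3
    exact (h2 h3).symm
  have h2 : 0 ≤ ω (hmem.toLp _) := by
    refine hω.nonneg _ ?_
    filter_upwards [hmem.coeFn_toLp] with t ht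
    rw [ht]
    exact abs_nonneg _
  rw [map_sub] at h1
  linarith

theorem HasOmegaLim.mono (hω : IsBanachLimit ω) (hf : HasOmegaLim ω f L)
    (hg : HasOmegaLim ω g L') (h : ∀ᶠ t in atTop, f t ≤ g t) : L ≤ L' := by
  have := (hg.sub hf).nonneg hω (h.mono fun t ht => sub_nonneg.mpr ht)
  linarith

theorem hasOmegaLim_of_tendsto (hω : IsBanachLimit ω) (hf : AEMeasurable f halfLine)
    (h : Tendsto f atTop (𝓝 L)) : HasOmegaLim ω f L := by
  have hb : ∀ᶠ t in atTop, |f t| ≤ |L| + 1 :=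
    (h.abs.eventually_lt_const (lt_add_one _)).mono fun t ht => ht.le
  obtain ⟨M, u, ⟨T, hu⟩, rfl⟩ := exists_hasOmegaLim (ω := ω) hf hb
  refine ⟨u, ⟨T, hu⟩, hω.eq_essLim _ _ ((h.mono_left inf_le_right).congr' ?_)⟩
  filter_upwards [Eventually.filter_mono inf_le_left hu,
    (eventually_gt_atTop T).filter_mono inf_le_right] with t h2 h3
  exact (h2 h3).symm

theorem HasOmegaLim.exists_ae_abs_le (h : HasOmegaLim ω f L) :
    ∃ C T : ℝ, ∀ᵐ t ∂halfLine, T < t → |f t| ≤ C := by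
  obtain ⟨u, ⟨T, hu⟩, -⟩ := h
  refine ⟨‖u‖, T, ?_⟩
  have hn := ae_le_eLpNormEssSup (f := u) (μ := halfLine)
  filter_upwards [hu, hn] with t h1 h2 hlt
  rw [← h1 hlt, Lp.norm_def, ← Real.norm_eq_abs, ← toReal_enorm]
  refine ENNReal.toReal_mono (Lp.eLpNorm_ne_top u) ?_
  rwa [eLpNorm_exponent_top]

/-- The preimage of a null set is its image under x ↦ x^{1/a}, which is differentiable on (0, ∞) and
so maps null sets to null sets. -/
theorem quasiMeasurePreserving_rpow {a : ℝ} (ha : 0 < a) :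
    Measure.QuasiMeasurePreserving (fun x : ℝ => x ^ a) halfLine halfLine := by
  refine ⟨by fun_prop, Measure.AbsolutelyContinuous.mk fun s hs h0 => ?_⟩
  rw [Measure.map_apply (by fun_prop) hs]
  rw [Measure.restrict_apply hs] at h0
  rw [Measure.restrict_apply ((by fun_prop : Measurable fun x : ℝ => x ^ a) hs)]
  have hd : DifferentiableOn ℝ (fun x : ℝ => x ^ a⁻¹) (s ∩ Ioi 0) := fun x hx =>
    (Real.differentiableAt_rpow_const_of_ne _ (ne_of_gt hx.2)).differentiableWithinAt
  refine measure_mono_null ?_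
    (addHaar_image_eq_zero_of_differentiableOn_of_addHaar_eq_zero volume hd h0)
  rintro x ⟨hx, hx0 : 0 < x⟩
  exact ⟨x ^ a, ⟨hx, Real.rpow_pos_of_pos hx0 a⟩, Real.rpow_rpow_inv hx0.le ha.ne'⟩

theorem HasOmegaLim.comp_rpow (hP : ∀ α : ℝ, 1 < α → IsPowerInvariant ω α)
    (h : HasOmegaLim ω f L) {a : ℝ} (ha : 0 < a) : HasOmegaLim ω (fun t => f (t ^ a)) L := by
  obtain ⟨u, ⟨T, hu⟩, rfl⟩ := h
  have hq := quasiMeasurePreserving_rpow ha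
  have hmem : MemLp (fun x => u (x ^ a)) ∞ halfLine := by
    refine ⟨(Lp.aestronglyMeasurable u).comp_quasiMeasurePreserving hq, ?_⟩
    rw [eLpNorm_exponent_top]
    refine lt_of_le_of_lt (eLpNormEssSup_le_of_ae_enorm_bound
      (hq.ae (ae_le_eLpNormEssSup (f := u) (μ := halfLine)))) ?_
    rw [← eLpNorm_exponent_top]
    exact Lp.eLpNorm_lt_top u
  refine ⟨hmem.toLp _, ⟨max T 0 ^ a⁻¹, ?_⟩, ?_⟩
  · filter_upwards [hmem.coeFn_toLp, hq.ae hu, ae_restrict_mem measurableSet_Ioi]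
      with t h1 h2 (h3 : 0 < t) hlt
    rw [h1]
    refine h2 ((le_max_left T 0).trans_lt ?_)
    exact (Real.rpow_inv_lt_iff_of_pos (le_max_right _ _) h3.le ha).mp hlt
  · rcases lt_trichotomy a 1 with h1 | rfl | h1
    -- For a < 1 the roles are exchanged: u is the power dilation by 1/a > 1 of the composed
    -- function.
    · refine (hP a⁻¹ ((one_lt_inv₀ ha).mpr h1) _ _ ?_).symm
      filter_upwards [(quasiMeasurePreserving_rpow (inv_pos.mpr ha)).ae hmem.coeFn_toLp,
        ae_restrict_mem measurableSet_Ioi] with t h2 (h3 : 0 < t)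
      rw [h2, Real.rpow_inv_rpow h3.le ha.ne']
    · congr 1
      refine Lp.ext ?_
      filter_upwards [hmem.coeFn_toLp] with t ht
      rw [ht, Real.rpow_one]
    · exact hP a h1 _ _ hmem.coeFn_toLp

end OmegaLim

/-! ### Monotone functions and their superlevel sets. -/

/-- A nonincreasing function on `(0, ∞)` that lies in `L^p` for all `p ∈ (1, p₀)`. -/
structure IsRearrangement (H : ℝ → ℝ) (p₀ : ℝ) : Prop where
  antitoneOn : AntitoneOn H (Ioi 0)
  one_lt : 1 < p₀
  memLp : ∀ p : ℝ, 1 < p → p < p₀ → MemLp H (ENNReal.ofReal p) halfLine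

/-- The set `{t > 0 : H t > l}`. -/
def superLevel (H : ℝ → ℝ) (l : ℝ) : Set ℝ := {t : ℝ | 0 < t ∧ l < H t}

theorem superLevel_anti {H : ℝ → ℝ} {l l' : ℝ} (h : l ≤ l') :
    superLevel H l' ⊆ superLevel H l := fun _ ht => ⟨ht.1, h.trans_lt ht.2⟩

theorem superLevel_subset_Ioi {H : ℝ → ℝ} {l : ℝ} : superLevel H l ⊆ Ioi 0 := fun _ ht => ht.1

theorem exp_mul_le_rpow {x u r : ℝ} (hr : 0 < r) (h : Real.exp (-u) ≤ x) :
    Real.exp (-(u / r)) * x ≤ x ^ (1 + 1 / r) := by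
  have hx : 0 < x := (Real.exp_pos _).trans_le h
  rw [Real.rpow_add hx, Real.rpow_one, mul_comm x]
  refine mul_le_mul_of_nonneg_right ?_ hx.le
  calc Real.exp (-(u / r)) = Real.exp (-u) ^ (1 / r) := by
        rw [← Real.exp_mul]; congr 1; ring
    _ ≤ _ := Real.rpow_le_rpow (Real.exp_pos _).le h (by positivity)

/-- The spare exponent s serves the region of small H: there H itself need not be integrable, but
H^{1+s} is for small s > 0. -/
theorem rpow_le_exp_mul_rpow {x u r s : ℝ} (hx : 0 ≤ x) (hr : 0 < r) (hs : 0 ≤ s)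
    (h : x ≤ Real.exp (-u)) :
    x ^ (1 + (s + 1 / r)) ≤ Real.exp (-(u / r)) * x ^ (1 + s) := by
  rcases hx.eq_or_lt with rfl | hx
  · rw [Real.zero_rpow (by positivity), Real.zero_rpow (by positivity), mul_zero]
  · rw [← add_assoc, Real.rpow_add hx, mul_comm]
    refine mul_le_mul_of_nonneg_right ?_ (by positivity)
    calc x ^ (1 / r) ≤ Real.exp (-u) ^ (1 / r) := Real.rpow_le_rpow hx.le h (by positivity)
      _ = _ := by rw [← Real.exp_mul]; congr 1; ring

theorem rpow_le_exp_mul {x u r : ℝ} (hx : 0 ≤ x) (hr : 0 < r) (h : x ≤ Real.exp (-u)) :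
    x ^ (1 + 1 / r) ≤ Real.exp (-(u / r)) * x := by
  simpa using rpow_le_exp_mul_rpow (s := 0) hx hr le_rfl h

namespace IsRearrangement

variable {H : ℝ → ℝ} {p₀ : ℝ}

theorem volume_lt_top (hH : IsRearrangement H p₀) {l : ℝ} (hl : 0 < l) :
    halfLine {t | l ≤ |H t|} < ∞ := by
  have h1 := hH.one_lt
  have hp0 : 0 < (1 + p₀) / 2 := by linarith
  have hm := hH.memLp ((1 + p₀) / 2) (by linarith) (by linarith)
  have h := meas_ge_le_mul_pow_eLpNorm_enorm halfLine (ε := ENNReal.ofReal l)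
    (ENNReal.ofReal_pos.mpr hp0).ne' ENNReal.ofReal_ne_top hm.1 (by simpa using hl) (fun h => absurd h ENNReal.ofReal_ne_top)
  refine lt_of_le_of_lt (measure_mono fun t ht => ?_) (h.trans_lt (ENNReal.mul_lt_top ?_ ?_))
  · simpa only [mem_ofPred_eq, Real.enorm_eq_ofReal_abs] using ENNReal.ofReal_le_ofReal ht
  · refine ENNReal.rpow_lt_top_of_nonneg (by positivity) ?_
    simpa using hl
  · exact ENNReal.rpow_lt_top_of_nonneg (by positivity) hm.2.ne

/-- By Chebyshev's inequality {|H| ≥ l} has finite measure. Both nonnegativity of H and boundedness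
of its superlevel sets follow from this. -/
theorem not_Ioi_subset (hH : IsRearrangement H p₀) {l : ℝ} (hl : 0 < l) (T : ℝ) :
    ¬ ∀ t, 0 < t → T < t → l ≤ |H t| := by
  intro h
  have h1 : halfLine (Ioi (max 0 T)) < ∞ := by
    refine lt_of_le_of_lt (measure_mono fun t ht => ?_) (hH.volume_lt_top hl)
    exact h t ((le_max_left _ _).trans_lt ht) ((le_max_right _ _).trans_lt ht)
  rw [Measure.restrict_apply measurableSet_Ioi, Ioi_inter_Ioi, Real.volume_Ioi] at h1
  exact lt_irrefl _ h1

theorem nonneg (hH : IsRearrangement H p₀) {s : ℝ} (hs : 0 < s) : 0 ≤ H s := by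
  by_contra! hneg
  refine hH.not_Ioi_subset (neg_pos.mpr hneg) s fun t ht hst => ?_
  have := hH.antitoneOn hs ht hst.le
  rw [abs_of_neg (this.trans_lt hneg)]
  linarith

theorem bddAbove_superLevel (hH : IsRearrangement H p₀) {l : ℝ} (hl : 0 < l) :
    BddAbove (superLevel H l) := by
  by_contra hb
  refine hH.not_Ioi_subset hl 0 fun t ht _ => ?_
  obtain ⟨s, hs, hts⟩ := not_bddAbove_iff.mp hb t
  exact hs.2.le.trans ((hH.antitoneOn ht hs.1 hts.le).trans (le_abs_self _))

theorem integrableOn_Ioc (hH : IsRearrangement H p₀) (t : ℝ) : IntegrableOn H (Ioc 0 t) := by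
  have h1 := hH.one_lt
  have hp1 : 1 < (1 + p₀) / 2 := by linarith
  have hp2 : (1 + p₀) / 2 < p₀ := by linarith
  have hm := (hH.memLp _ hp1 hp2).mono_measure
    (Measure.restrict_mono (Ioc_subset_Ioi_self : Ioc 0 t ⊆ Ioi 0) le_rfl)
  exact memLp_one_iff_integrable.mp (hm.mono_exponent (by simpa using hp1.le))

theorem integrableOn_rpow (hH : IsRearrangement H p₀) {p : ℝ} (hp : 1 < p) (hpp : p < p₀) :
    IntegrableOn (fun s => H s ^ p) (Ioi 0) := by
  have h := (hH.memLp p hp hpp).integrable_norm_rpow (by simpa using by linarith)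
    ENNReal.ofReal_ne_top
  rw [ENNReal.toReal_ofReal (by linarith)] at h
  refine (integrable_congr ?_).mp h
  filter_upwards [ae_restrict_mem measurableSet_Ioi] with s hs
  rw [Real.norm_of_nonneg (hH.nonneg hs)]

theorem measurableSet_superLevel (hH : IsRearrangement H p₀) (l : ℝ) :
    MeasurableSet (superLevel H l) := by
  refine OrdConnected.measurableSet ⟨fun x hx y hy z hz => ?_⟩
  have hz0 := hx.1.trans_le hz.1
  exact ⟨hz0, hy.2.trans_le (hH.antitoneOn hz0 hy.1 hz.2)⟩

theorem superLevel_subset_Ioc (hH : IsRearrangement H p₀) {l : ℝ} (hl : 0 < l) :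
    superLevel H l ⊆ Ioc 0 (distFun H l) :=
  fun _ ht => ⟨ht.1, le_csSup (hH.bddAbove_superLevel hl) ht⟩

theorem mem_superLevel_of_lt_distFun (hH : IsRearrangement H p₀) {l t : ℝ} (ht : 0 < t)
    (h : t < distFun H l) : t ∈ superLevel H l := by
  have hne : (superLevel H l).Nonempty := by
    by_contra hne
    rw [not_nonempty_iff_eq_empty] at hne
    have : distFun H l = 0 := by
      change sSup (superLevel H l) = 0
      rw [hne, Real.sSup_empty]
    linarith
  obtain ⟨s, hs, hts⟩ := exists_lt_of_lt_csSup hne h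
  exact ⟨ht, hs.2.trans_le (hH.antitoneOn ht hs.1 hts.le)⟩

/-- By monotonicity the two sets can differ only at the right endpoint, so no one-sided continuity
of H is needed. -/
theorem superLevel_ae_eq (hH : IsRearrangement H p₀) {l : ℝ} (hl : 0 < l) :
    superLevel H l =ᵐ[volume] Ioc 0 (distFun H l) := by
  refine (hH.superLevel_subset_Ioc hl).eventuallyLE.antisymm ?_
  refine Ioo_ae_eq_Ioc.symm.le.trans (LE.le.eventuallyLE fun t ht => ?_)
  exact hH.mem_superLevel_of_lt_distFun ht.1 ht.2

theorem setIntegral_distFun (hH : IsRearrangement H p₀) {l : ℝ} (hl : 0 < l) :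
    ∫ s in Ioc 0 (distFun H l), H s = ∫ s in superLevel H l, H s :=
  (setIntegral_congr_set (hH.superLevel_ae_eq hl)).symm

theorem integrableOn_superLevel (hH : IsRearrangement H p₀) {l : ℝ} (hl : 0 < l) :
    IntegrableOn H (superLevel H l) :=
  (hH.integrableOn_Ioc _).mono_set (hH.superLevel_subset_Ioc hl)

theorem setIntegral_mono (hH : IsRearrangement H p₀) {A B : Set ℝ} (hB : B ⊆ Ioi 0)
    (hm : MeasurableSet B) (hi : IntegrableOn H B) (hAB : A ⊆ B) :
    ∫ s in A, H s ≤ ∫ s in B, H s := by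
  refine setIntegral_mono_set hi ?_ hAB.eventuallyLE
  filter_upwards [ae_restrict_mem hm] with s hs using hH.nonneg (hB hs)

theorem setIntegral_rpow_mono (hH : IsRearrangement H p₀) {p : ℝ} (hp : 1 < p) (hpp : p < p₀)
    {A B : Set ℝ} (hB : B ⊆ Ioi 0) (hm : MeasurableSet B) (hAB : A ⊆ B) :
    ∫ s in A, H s ^ p ≤ ∫ s in B, H s ^ p := by
  refine setIntegral_mono_set ((hH.integrableOn_rpow hp hpp).mono_set hB) ?_ hAB.eventuallyLE
  filter_upwards [ae_restrict_mem hm] with s hs using Real.rpow_nonneg (hH.nonneg (hB hs)) _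

theorem setIntegral_nonneg (hH : IsRearrangement H p₀) {A : Set ℝ} (hA : A ⊆ Ioi 0)
    (hm : MeasurableSet A) : 0 ≤ ∫ s in A, H s :=
  MeasureTheory.setIntegral_nonneg hm fun _ hs => hH.nonneg (hA hs)

theorem monotone_setIntegral_Ioc (hH : IsRearrangement H p₀) :
    Monotone fun t => ∫ s in Ioc 0 t, H s := fun _ b hab =>
  hH.setIntegral_mono Ioc_subset_Ioi_self measurableSet_Ioc (hH.integrableOn_Ioc b)
    (Ioc_subset_Ioc_right hab)

theorem setIntegral_superLevel_anti (hH : IsRearrangement H p₀) {l l' : ℝ} (hl : 0 < l)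
    (h : l ≤ l') : ∫ s in superLevel H l', H s ≤ ∫ s in superLevel H l, H s :=
  hH.setIntegral_mono superLevel_subset_Ioi (hH.measurableSet_superLevel l)
    (hH.integrableOn_superLevel hl) (superLevel_anti h)

/-- Here H ≤ 1/t on a set of measure at most t. -/
theorem setIntegral_Ioc_sdiff_le (hH : IsRearrangement H p₀) {t : ℝ} (ht : 0 < t) :
    ∫ s in Ioc 0 t \ superLevel H (1 / t), H s ≤ 1 := by
  have hv : volume (Ioc 0 t \ superLevel H (1 / t)) ≤ ENNReal.ofReal t := by
    refine (measure_mono sdiff_subset).trans ?_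
    simp
  have h := norm_setIntegral_le_of_norm_le_const (C := 1 / t) (f := H)
    (hv.trans_lt ENNReal.ofReal_lt_top) (fun s hs => ?_)
  · refine (le_abs_self _).trans (h.trans ?_)
    calc 1 / t * volume.real (Ioc 0 t \ superLevel H (1 / t)) ≤ 1 / t * t := by
          refine mul_le_mul_of_nonneg_left ?_ (by positivity)
          exact ENNReal.toReal_le_of_le_ofReal ht.le hv
      _ = 1 := by field_simp
  · rw [Real.norm_of_nonneg (hH.nonneg hs.1.1)]
    by_contra! hc
    exact hs.2 ⟨hs.1.1, hc⟩

theorem setIntegral_Ioc_le (hH : IsRearrangement H p₀) {t : ℝ} (ht : 0 < t) :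
    ∫ s in Ioc 0 t, H s ≤ (∫ s in Ioc 0 t ∩ superLevel H (1 / t), H s) + 1 := by
  rw [← integral_inter_add_sdiff (hH.measurableSet_superLevel (1 / t)) (hH.integrableOn_Ioc t)]
  gcongr
  exact hH.setIntegral_Ioc_sdiff_le ht

theorem setIntegral_Ioc_le_superLevel (hH : IsRearrangement H p₀) {t : ℝ} (ht : 0 < t) :
    ∫ s in Ioc 0 t, H s ≤ (∫ s in superLevel H (1 / t), H s) + 1 := by
  refine (hH.setIntegral_Ioc_le ht).trans ?_
  refine add_le_add_left ?_ 1
  exact hH.setIntegral_mono superLevel_subset_Ioi (hH.measurableSet_superLevel _)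
    (hH.integrableOn_superLevel (by positivity)) inter_subset_right

theorem one_lt_exponent {r : ℝ} (hr0 : 0 < r) : 1 < 1 + 1 / r := by
  have : 0 < 1 / r := by positivity
  linarith

/-- Where H > 1/t, H^{1/log t} ≥ e^{-1}; the rest of (0, t] contributes at most 1. This yields c_H <
∞ when the left side of (c) is defined. -/
theorem setIntegral_Ioc_le_rpow (hH : IsRearrangement H p₀) {t : ℝ} (ht : 1 < t)
    (hp : 1 + 1 / Real.log t < p₀) :
    ∫ s in Ioc 0 t, H s ≤ Real.exp 1 * (∫ s in Ioi 0, H s ^ (1 + 1 / Real.log t)) + 1 := by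
  have h0 : 0 < t := by linarith
  have hl := Real.log_pos ht
  have hp1 := one_lt_exponent hl
  refine (hH.setIntegral_Ioc_le h0).trans ?_
  gcongr
  have hsub : Ioc 0 t ∩ superLevel H (1 / t) ⊆ Ioi 0 := fun s hs => hs.1.1
  have hmeas := (measurableSet_Ioc (a := 0) (b := t)).inter (hH.measurableSet_superLevel (1 / t))
  calc ∫ s in Ioc 0 t ∩ superLevel H (1 / t), H s
      ≤ ∫ s in Ioc 0 t ∩ superLevel H (1 / t), Real.exp 1 * H s ^ (1 + 1 / Real.log t) := by
        refine setIntegral_mono_on ((hH.integrableOn_Ioc t).mono_set inter_subset_left)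
          (((hH.integrableOn_rpow hp1 hp).mono_set hsub).const_mul _) hmeas fun s hs => ?_
        have h1 : Real.exp (-Real.log t) ≤ H s := by
          rw [Real.exp_neg, Real.exp_log h0, ← one_div]
          exact hs.2.2.le
        have h2 := exp_mul_le_rpow hl h1
        rw [div_self hl.ne'] at h2
        calc H s = Real.exp 1 * (Real.exp (-1) * H s) := by
              rw [← mul_assoc, ← Real.exp_add]; simp
          _ ≤ _ := by gcongr
    _ ≤ _ := by
        rw [integral_const_mul]
        refine mul_le_mul_of_nonneg_left ?_ (Real.exp_pos _).le
        exact hH.setIntegral_rpow_mono hp1 hp Subset.rfl measurableSet_Ioi hsub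

end IsRearrangement

/-! ### Logarithmic growth: the bound on μ_H and the common limit in (b). -/

theorem eventually_mul_log_le_rpow {c α : ℝ} (hc : 0 < c) (hα : 1 < α) :
    ∀ᶠ t in atTop, c * t * Real.log t ≤ t ^ α := by
  have h := (isLittleO_log_rpow_atTop (sub_pos.mpr hα)).bound (inv_pos.mpr hc)
  filter_upwards [h, eventually_gt_atTop 1] with t ht h1
  have h0 : 0 < t := by linarith
  rw [Real.norm_of_nonneg (Real.log_pos h1).le, Real.norm_of_nonneg (by positivity)] at ht
  calc c * t * Real.log t ≤ c * t * (c⁻¹ * t ^ (α - 1)) := by gcongr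
    _ = t * t ^ (α - 1) := by field_simp
    _ = t ^ α := by
      rw [← Real.rpow_one_add' h0.le (by linarith)]
      congr 1
      ring

theorem tendsto_const_div_log (D : ℝ) : Tendsto (fun t => 1 / Real.log t * D) atTop (𝓝 0) := by
  simpa using (Real.tendsto_log_atTop.inv_tendsto_atTop).mul_const D

theorem eventually_one_lt_mul_log {c : ℝ} (hc : 0 < c) (B : ℝ) :
    ∀ᶠ t in atTop, B < c * t * Real.log t :=
  ((tendsto_id.const_mul_atTop hc).atTop_mul_atTop₀ Real.tendsto_log_atTop).eventually_gt_atTop B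

namespace IsRearrangement

variable {H : ℝ → ℝ} {p₀ : ℝ} {ω : LInfty →L[ℝ] ℝ} {L : ℝ}

theorem exists_bound_of_cSup_lt (hH : IsRearrangement H p₀) {c : ℝ} (hc : cSup H < (c : EReal)) :
    ∃ c' : ℝ, 0 ≤ c' ∧ c' < c ∧ ∀ t, 2 < t → ∫ s in Ioc 0 t, H s ≤ c' * Real.log t := by
  obtain ⟨c', h1, h2⟩ := EReal.lt_iff_exists_real_btwn.mp hc
  have key : ∀ t, 2 < t → ∫ s in Ioc 0 t, H s ≤ c' * Real.log t := fun t ht => by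
    have hl : 0 < Real.log t := Real.log_pos (by linarith)
    have h3 : ((1 / Real.log t * ∫ s in Ioc 0 t, H s : ℝ) : EReal) ≤ c' :=
      (le_iSup₂_of_le (f := fun t (_ : t ∈ Ioi (2 : ℝ)) =>
        ((1 / Real.log t * ∫ s in Ioc 0 t, H s : ℝ) : EReal)) t ht le_rfl).trans h1.le
    have h4 := EReal.coe_le_coe_iff.mp h3
    rwa [one_div, inv_mul_le_iff₀ hl, mul_comm] at h4
  refine ⟨c', ?_, EReal.coe_lt_coe_iff.mp h2, key⟩
  have h3 := (hH.setIntegral_nonneg (A := Ioc 0 3) Ioc_subset_Ioi_self measurableSet_Ioc).trans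
    (key 3 (by norm_num))
  exact nonneg_of_mul_nonneg_left h3 (Real.log_pos (by norm_num))

theorem cSup_lt_top (hH : IsRearrangement H p₀) {C T : ℝ} (hC : 0 ≤ C)
    (h : ∀ᵐ t ∂halfLine, T < t → ∫ s in Ioc 0 t, H s ≤ C * Real.log t) : cSup H < ⊤ := by
  wlog hT : 2 ≤ T generalizing T
  · exact this (T := 2) (h.mono fun t ht h2 => ht (by linarith)) le_rfl
  have key : ∀ t, T ≤ t → ∫ s in Ioc 0 t, H s ≤ C * Real.log (t + 1) := fun t ht => by
    rw [ae_restrict_iff' measurableSet_Ioi] at h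
    -- The bound holds only almost everywhere, so it is taken at some u in (t, t + 1) and carried
    -- back to t by monotonicity of the integral.
    have hne : ∃ᵐ u, u ∈ Ioo t (t + 1) := by
      rw [frequently_ae_mem_iff]
      simp
    obtain ⟨u, hu, hu'⟩ := (hne.and_eventually h).exists
    have h0 : 0 < u := by linarith [hu.1]
    refine (hH.monotone_setIntegral_Ioc hu.1.le).trans ((hu' h0 (by linarith [hu.1])).trans ?_)
    have := hu.2.le
    gcongr
  have hlT : 0 < Real.log (T + 1) := Real.log_pos (by linarith)
  have hl2 : 0 < Real.log 2 := Real.log_pos (by norm_num)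
  refine lt_of_le_of_lt (b := ((2 * C + C * Real.log (T + 1) / Real.log 2 : ℝ) : EReal)) ?_
    (EReal.coe_lt_top _)
  refine iSup₂_le fun t (ht : 2 < t) => EReal.coe_le_coe_iff.mpr ?_
  have hlt : Real.log 2 ≤ Real.log t := Real.log_le_log (by norm_num) ht.le
  have hl : 0 < Real.log t := hl2.trans_le hlt
  rw [one_div, inv_mul_le_iff₀ hl]
  rcases le_total t T with htT | htT
  · refine (hH.monotone_setIntegral_Ioc htT).trans ((key T le_rfl).trans ?_)
    have h1 : C * Real.log (T + 1) ≤ Real.log t * (C * Real.log (T + 1) / Real.log 2) := by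
      rw [← mul_div_assoc, le_div_iff₀ hl2, mul_comm]
      gcongr
    nlinarith [mul_nonneg hl.le hC]
  · refine (key t htT).trans ?_
    have h1 : Real.log (t + 1) ≤ 2 * Real.log t := by
      rw [← Real.log_rpow (by linarith)]
      refine Real.log_le_log (by linarith) ?_
      norm_num
      nlinarith
    have h2 : 0 ≤ Real.log t * (C * Real.log (T + 1) / Real.log 2) := by positivity
    nlinarith

theorem eventually_distFun_le (hH : IsRearrangement H p₀) {c : ℝ} (hc : cSup H < (c : EReal)) :
    ∀ᶠ t in atTop, distFun H (1 / t) ≤ c * t * Real.log t := by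
  obtain ⟨c', hc0, hcc, hb⟩ := hH.exists_bound_of_cSup_lt hc
  have hcpos := hc0.trans_lt hcc
  obtain ⟨α, hα, hαc⟩ : ∃ α : ℝ, 1 < α ∧ c' * α < c := by
    -- With this α, c'α = c' + (c - c')·c'/(c' + 1), which is less than c because c'/(c' + 1) < 1.
    refine ⟨1 + (c - c') / (c' + 1), ?_, ?_⟩
    · have : 0 < (c - c') / (c' + 1) := div_pos (by linarith) (by linarith)
      linarith
    · have h1 : (c - c') / (c' + 1) * (c' + 1) = c - c' := div_mul_cancel₀ _ (by linarith)
      have : 0 < (c - c') / (c' + 1) := div_pos (by linarith) (by linarith)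
      nlinarith
  filter_upwards [eventually_mul_log_le_rpow hcpos hα, eventually_one_lt_mul_log hcpos 2,
    eventually_gt_atTop 1] with t h1 h2 ht
  have h0 : 0 < t := by linarith
  have hl := Real.log_pos ht
  refine Real.sSup_le (fun x hx => ?_) (by positivity)
  by_contra! hlt
  set s := c * t * Real.log t with hs
  -- A point x > s with H(x) > 1/t forces H > 1/t on all of (0, s]; as s/t = c log t, this
  -- contradicts the upper bound c' log s ≤ c'α log t.
  have hlow : s * (1 / t) ≤ ∫ u in Ioc 0 s, H u := by
    have h3 : ∫ _ in Ioc 0 s, (1 / t) = s * (1 / t) := by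
      rw [setIntegral_const, smul_eq_mul, Real.volume_real_Ioc_of_le (by linarith), sub_zero]
    rw [← h3]
    refine setIntegral_mono_on (integrableOn_const (by simp)) (hH.integrableOn_Ioc s)
      measurableSet_Ioc fun u hu => ?_
    exact hx.2.le.trans (hH.antitoneOn hu.1 hx.1 (hu.2.trans hlt.le))
  have h4 : Real.log s ≤ α * Real.log t := by
    rw [← Real.log_rpow h0]
    exact Real.log_le_log (by linarith) h1
  have h5 : s * (1 / t) = c * Real.log t := by rw [hs]; field_simp
  have h6 := hb s h2
  have h7 := mul_le_mul_of_nonneg_left h4 hc0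
  nlinarith

theorem hasOmegaLim_rpow (hP : ∀ α : ℝ, 1 < α → IsPowerInvariant ω α) {J : ℝ → ℝ}
    (hL : HasOmegaLim ω (fun t => 1 / Real.log t * J t) L)
    {α : ℝ} (hα : 0 < α) : HasOmegaLim ω (fun t => 1 / Real.log t * J (t ^ α)) (α * L) := by
  refine ((hL.comp_rpow hP hα).const_mul α).congr ?_
  filter_upwards [eventually_gt_atTop 1] with t ht
  have hl := Real.log_pos ht
  rw [Real.log_rpow (by linarith)]
  field_simp

theorem monotoneOn_superLevel (hH : IsRearrangement H p₀) :
    MonotoneOn (fun t => ∫ s in superLevel H (1 / t), H s) (Ioi 0) := fun _ hx _ hy hxy =>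
  hH.setIntegral_superLevel_anti (one_div_pos.mpr hy) (one_div_le_one_div_of_le hx hxy)

theorem exists_superLevel_bound (hH : IsRearrangement H p₀) (hc : cSup H < ⊤) :
    ∃ C : ℝ, 0 ≤ C ∧ ∀ᶠ t in atTop, ∫ s in superLevel H (1 / t), H s ≤ C * Real.log t := by
  obtain ⟨c, hc, -⟩ := EReal.lt_iff_exists_real_btwn.mp hc
  obtain ⟨c', hc0, hcc, hb⟩ := hH.exists_bound_of_cSup_lt hc
  refine ⟨2 * c', by positivity, ?_⟩
  filter_upwards [hH.eventually_distFun_le hc, eventually_gt_atTop 2,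
    eventually_mul_log_le_rpow (hc0.trans_lt hcc) one_lt_two] with t h1 h2 h3
  rw [← hH.setIntegral_distFun (one_div_pos.mpr (by linarith))]
  refine (hH.monotone_setIntegral_Ioc (h1.trans h3)).trans ?_
  have h4 := hb (t ^ (2 : ℝ)) (by norm_num; nlinarith)
  rw [Real.log_rpow (by linarith)] at h4
  linarith

/-- The three logarithmic averages have the same generalized limit. -/
theorem exists_common_omegaLim (hH : IsRearrangement H p₀) (hω : IsBanachLimit ω)
    (hP : ∀ α : ℝ, 1 < α → IsPowerInvariant ω α) {c : ℝ} (hc : cSup H < (c : EReal)) :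
    ∃ L : ℝ,
      HasOmegaLim ω (fun t => 1 / Real.log t * ∫ s in Ioc 0 t, H s) L ∧
      HasOmegaLim ω (fun t => 1 / Real.log t * ∫ s in Ioc 0 (c * t * Real.log t), H s) L ∧
      HasOmegaLim ω (fun t => 1 / Real.log t * ∫ s in superLevel H (1 / t), H s) L := by
  obtain ⟨c', hc0, hcc, hb⟩ := hH.exists_bound_of_cSup_lt hc
  have hcpos := hc0.trans_lt hcc
  have hbound : ∀ᶠ t in atTop, 1 / Real.log t * ∫ s in Ioc 0 (t ^ (2 : ℝ)), H s ≤ c' * 2 := by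
    filter_upwards [eventually_gt_atTop 2] with t ht
    have hl : 0 < Real.log t := Real.log_pos (by linarith)
    have h1 := hb (t ^ (2 : ℝ)) (by norm_num; nlinarith)
    rw [Real.log_rpow (by linarith)] at h1
    rw [one_div, inv_mul_le_iff₀ hl]
    linarith
  have hIcc : ∀ t, 0 ≤ ∫ s in Ioc 0 t, H s := fun t =>
    hH.setIntegral_nonneg Ioc_subset_Ioi_self measurableSet_Ioc
  have hlog : ∀ᶠ t in atTop, 0 < 1 / Real.log t := by
    filter_upwards [eventually_gt_atTop 1] with t ht using one_div_pos.mpr (Real.log_pos ht)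
  have hMN : ∀ᶠ t in atTop, 1 / Real.log t * ∫ s in superLevel H (1 / t), H s ≤
      1 / Real.log t * ∫ s in Ioc 0 (c * t * Real.log t), H s := by
    filter_upwards [hlog, hH.eventually_distFun_le hc, eventually_gt_atTop 0] with t h1 h2 h3
    rw [← hH.setIntegral_distFun (one_div_pos.mpr h3)]
    exact mul_le_mul_of_nonneg_left (hH.monotone_setIntegral_Ioc h2) h1.le
  have hN : ∀ α : ℝ, 1 < α → ∀ᶠ t in atTop,
      1 / Real.log t * ∫ s in Ioc 0 (c * t * Real.log t), H s ≤
      1 / Real.log t * ∫ s in Ioc 0 (t ^ α), H s := fun α hα => by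
    filter_upwards [hlog, eventually_mul_log_le_rpow hcpos hα] with t h1 h2
    exact mul_le_mul_of_nonneg_left (hH.monotone_setIntegral_Ioc h2) h1.le
  have hmeas := hH.monotone_setIntegral_Ioc.measurable
  have hlogm : Measurable fun t => 1 / Real.log t := by fun_prop
  obtain ⟨L, hL⟩ := exists_hasOmegaLim (ω := ω) (f := fun t => 1 / Real.log t * ∫ s in Ioc 0 t, H s)
    (C := c') (hlogm.mul hmeas).aemeasurable (by
    filter_upwards [hlog, eventually_gt_atTop 2] with t h1 h2
    rw [abs_of_nonneg (mul_nonneg h1.le (hIcc t)), one_div,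
      inv_mul_le_iff₀ (one_div_pos.mp h1), mul_comm]
    exact hb t h2)
  obtain ⟨LN, hLN⟩ := exists_hasOmegaLim (ω := ω)
    (f := fun t => 1 / Real.log t * ∫ s in Ioc 0 (c * t * Real.log t), H s) (C := c' * 2)
    (hlogm.mul (hmeas.comp (by fun_prop : Measurable fun t => c * t * Real.log t))).aemeasurable (by
    filter_upwards [hlog, hN 2 one_lt_two, hbound] with t h1 h2 h3
    rw [abs_of_nonneg (mul_nonneg h1.le (hIcc _))]
    exact h2.trans h3)
  obtain ⟨LM, hLM⟩ := exists_hasOmegaLim (ω := ω)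
    (f := fun t => 1 / Real.log t * ∫ s in superLevel H (1 / t), H s) (C := c' * 2)
    (hlogm.aemeasurable.mul
      (aemeasurable_restrict_of_monotoneOn measurableSet_Ioi hH.monotoneOn_superLevel)) (by
    filter_upwards [hlog, hMN, hN 2 one_lt_two, hbound] with t h1 h2 h3 h4
    rw [abs_of_nonneg (mul_nonneg h1.le
      (hH.setIntegral_nonneg superLevel_subset_Ioi (hH.measurableSet_superLevel _)))]
    exact h2.trans (h3.trans h4))
  have h1 : LM ≤ LN := hLM.mono hω hLN hMN
  -- The additive error 1 disappears after division by log t.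
  have h2 : L ≤ LM := by
    have h3 := hLM.add (hasOmegaLim_of_tendsto hω (hlogm.mul_const 1).aemeasurable
      (tendsto_const_div_log 1))
    rw [add_zero] at h3
    refine hL.mono hω h3 ?_
    filter_upwards [hlog, eventually_gt_atTop 0] with t h4 h5
    rw [← mul_add]
    exact mul_le_mul_of_nonneg_left (hH.setIntegral_Ioc_le_superLevel h5) h4.le
  -- Comparison with t^α gives LN ≤ αL for every α > 1; then α → 1.
  have h3 : LN ≤ L := by
    have h4 : ∀ α : ℝ, 1 < α → LN ≤ α * L := fun α hα =>
      hLN.mono hω (hasOmegaLim_rpow hP hL (by linarith)) (hN α hα)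
    have h5 : Tendsto (fun α : ℝ => α * L) (𝓝[>] 1) (𝓝 (1 * L)) :=
      ((continuous_id.mul continuous_const).tendsto 1).mono_left nhdsWithin_le_nhds
    rw [one_mul] at h5
    exact ge_of_tendsto h5 (eventually_mem_nhdsWithin.mono h4)
  obtain rfl : LM = L := by linarith
  obtain rfl : LN = LM := by linarith
  exact ⟨_, hL, hLN, hLM⟩

/-! ### Shell decomposition of the integral of H^{1+1/r}. -/

theorem rpow_shell_bounds (hH : IsRearrangement H p₀) {r u v : ℝ} (hr : 0 < r)
    (hp : 1 + 1 / r < p₀) (huv : u ≤ v) :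
    Real.exp (-(v / r)) * ((∫ s in superLevel H (Real.exp (-v)), H s) -
        ∫ s in superLevel H (Real.exp (-u)), H s) ≤
      (∫ s in superLevel H (Real.exp (-v)), H s ^ (1 + 1 / r)) -
        ∫ s in superLevel H (Real.exp (-u)), H s ^ (1 + 1 / r) ∧
    (∫ s in superLevel H (Real.exp (-v)), H s ^ (1 + 1 / r)) -
        ∫ s in superLevel H (Real.exp (-u)), H s ^ (1 + 1 / r) ≤
      Real.exp (-(u / r)) * ((∫ s in superLevel H (Real.exp (-v)), H s) -
        ∫ s in superLevel H (Real.exp (-u)), H s) := by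
  have hsub : superLevel H (Real.exp (-u)) ⊆ superLevel H (Real.exp (-v)) :=
    superLevel_anti (Real.exp_le_exp.mpr (by linarith))
  have hmu := hH.measurableSet_superLevel (Real.exp (-u))
  have hmv := hH.measurableSet_superLevel (Real.exp (-v))
  have hi := hH.integrableOn_superLevel (Real.exp_pos (-v))
  have hip := (hH.integrableOn_rpow (one_lt_exponent hr) hp).mono_set
    (superLevel_subset_Ioi (H := H) (l := Real.exp (-v)))
  rw [← setIntegral_sdiff hmu hi hsub, ← setIntegral_sdiff hmu hip hsub,
    ← integral_const_mul, ← integral_const_mul]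
  have hi' := hi.mono_set (sdiff_subset (t := superLevel H (Real.exp (-u))))
  have hip' := hip.mono_set (sdiff_subset (t := superLevel H (Real.exp (-u))))
  constructor
  · refine setIntegral_mono_on (hi'.const_mul _) hip' (hmv.diff hmu) fun s hs => ?_
    exact exp_mul_le_rpow hr hs.1.2.le
  · refine setIntegral_mono_on hip' (hi'.const_mul _) (hmv.diff hmu) fun s hs => ?_
    refine rpow_le_exp_mul (hH.nonneg hs.1.1) hr ?_
    by_contra! h
    exact hs.2 ⟨hs.1.1, h⟩

/-- Levels e^{-kdr} scale with r so that the weights e^{-kd} do not depend on r; ω can then be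
applied term by term to the finite sums. -/
theorem rpow_sum_bounds (hH : IsRearrangement H p₀) {r d : ℝ} (hr : 0 < r) (hd : 0 < d)
    (hp : 1 + 1 / r < p₀) (K : ℕ) :
    ∑ k ∈ Finset.range K, Real.exp (-((k + 1 : ℕ) * d)) *
        ((∫ s in superLevel H (Real.exp (-((k + 1 : ℕ) * d * r))), H s) -
          ∫ s in superLevel H (Real.exp (-(k * d * r))), H s) ≤
      (∫ s in superLevel H (Real.exp (-(K * d * r))), H s ^ (1 + 1 / r)) -
        ∫ s in superLevel H 1, H s ^ (1 + 1 / r) ∧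
    (∫ s in superLevel H (Real.exp (-(K * d * r))), H s ^ (1 + 1 / r)) -
        ∫ s in superLevel H 1, H s ^ (1 + 1 / r) ≤
      ∑ k ∈ Finset.range K, Real.exp (-(k * d)) *
        ((∫ s in superLevel H (Real.exp (-((k + 1 : ℕ) * d * r))), H s) -
          ∫ s in superLevel H (Real.exp (-(k * d * r))), H s) := by
  have htel := Finset.sum_range_sub
    (fun k : ℕ => ∫ s in superLevel H (Real.exp (-(k * d * r))), H s ^ (1 + 1 / r)) K
  simp only [Nat.cast_zero, zero_mul, neg_zero, Real.exp_zero] at htel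
  rw [← htel]
  have key : ∀ k : ℕ, _ := fun k => hH.rpow_shell_bounds (u := k * d * r)
    (v := (k + 1 : ℕ) * d * r) hr hp (by push_cast; gcongr; linarith)
  simp only [mul_div_cancel_right₀ _ hr.ne'] at key
  exact ⟨Finset.sum_le_sum fun k _ => (key k).1, Finset.sum_le_sum fun k _ => (key k).2⟩

theorem one_add_one_div_two_mul_lt {r : ℝ} (hr : 0 < r) (hp : 1 + 1 / r < p₀) :
    1 + 1 / (2 * r) < p₀ := by
  refine lt_of_le_of_lt ?_ hp
  gcongr
  linarith

/-- Split 1/r into two halves: one gives the small factor, the other keeps the remaining power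
integrable. -/
theorem rpow_tail_le (hH : IsRearrangement H p₀) {r u : ℝ} (hr : 0 < r) (hp : 1 + 1 / r < p₀) :
    (∫ s in Ioi 0, H s ^ (1 + 1 / r)) - ∫ s in superLevel H (Real.exp (-u)), H s ^ (1 + 1 / r) ≤
      Real.exp (-(u / (2 * r))) * ∫ s in Ioi 0, H s ^ (1 + 1 / (2 * r)) := by
  have hm := hH.measurableSet_superLevel (Real.exp (-u))
  have hip := hH.integrableOn_rpow (one_lt_exponent hr) hp
  have hr2 : 0 < 2 * r := by positivity
  have hp2 := one_add_one_div_two_mul_lt hr hp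
  have hip2 := hH.integrableOn_rpow (one_lt_exponent hr2) hp2
  rw [← setIntegral_sdiff hm hip superLevel_subset_Ioi]
  calc ∫ s in Ioi 0 \ superLevel H (Real.exp (-u)), H s ^ (1 + 1 / r)
      ≤ ∫ s in Ioi 0 \ superLevel H (Real.exp (-u)),
          Real.exp (-(u / (2 * r))) * H s ^ (1 + 1 / (2 * r)) := by
        refine setIntegral_mono_on (hip.mono_set sdiff_subset)
          ((hip2.mono_set sdiff_subset).const_mul _) (measurableSet_Ioi.diff hm) fun s hs => ?_
        have h : H s ≤ Real.exp (-u) := by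
          by_contra! h
          exact hs.2 ⟨hs.1, h⟩
        have h2 := rpow_le_exp_mul_rpow (s := 1 / (2 * r)) (hH.nonneg hs.1) hr2 (by positivity) h
        have he : 1 + 1 / r = 1 + (1 / (2 * r) + 1 / (2 * r)) := by ring
        rwa [he]
    _ ≤ _ := by
        rw [integral_const_mul]
        refine mul_le_mul_of_nonneg_left ?_ (Real.exp_pos _).le
        exact hH.setIntegral_rpow_mono (one_lt_exponent hr2) hp2 Subset.rfl measurableSet_Ioi
          sdiff_subset

/-- Where H > 1, raising the exponent to the fixed value (1 + p₀)/2 only increases the power. -/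
theorem rpow_head_le (hH : IsRearrangement H p₀) :
    ∃ D : ℝ, ∀ᶠ r in atTop, 0 < r ∧ 1 + 1 / r < p₀ ∧
      ∫ s in superLevel H 1, H s ^ (1 + 1 / r) ≤ D := by
  have h1 := hH.one_lt
  have hq1 : 1 < (1 + p₀) / 2 := by linarith
  have hq2 : (1 + p₀) / 2 < p₀ := by linarith
  refine ⟨∫ s in superLevel H 1, H s ^ ((1 + p₀) / 2), ?_⟩
  have ht : Tendsto (fun r : ℝ => 1 + 1 / r) atTop (𝓝 1) := by
    simpa using tendsto_inv_atTop_zero.const_add (1 : ℝ)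
  filter_upwards [eventually_gt_atTop 0, ht.eventually_lt_const hq1] with r hr hrq
  have hp := hrq.trans hq2
  refine ⟨hr, hp, ?_⟩
  refine setIntegral_mono_on
    ((hH.integrableOn_rpow (one_lt_exponent hr) hp).mono_set superLevel_subset_Ioi)
    ((hH.integrableOn_rpow hq1 hq2).mono_set superLevel_subset_Ioi)
    (hH.measurableSet_superLevel 1) fun s hs => ?_
  exact Real.rpow_le_rpow_of_exponent_le hs.2.le hrq.le

theorem setIntegral_rpow_nonneg (hH : IsRearrangement H p₀) {A : Set ℝ} (hA : A ⊆ Ioi 0)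
    (hm : MeasurableSet A) (q : ℝ) : 0 ≤ ∫ s in A, H s ^ q :=
  MeasureTheory.setIntegral_nonneg hm fun _ hs => Real.rpow_nonneg (hH.nonneg (hA hs)) q

/-- Shells of width d = 1 contribute at most Σ e^{-k}(k + 1)Cr, and for fixed r the tail vanishes as
K → ∞. The bound ensures that the left side of (c) is defined at all. -/
theorem exists_rpow_bound (hH : IsRearrangement H p₀) (hc : cSup H < ⊤) :
    ∃ C : ℝ, ∀ᶠ r in atTop, ∫ s in Ioi 0, H s ^ (1 + 1 / r) ≤ C * r := by
  obtain ⟨D, hD⟩ := hH.rpow_head_le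
  obtain ⟨C, hC, hb⟩ := hH.exists_superLevel_bound hc
  obtain ⟨u₀, hu⟩ := eventually_atTop.mp (Real.tendsto_exp_atTop.eventually hb)
  have hsum : Summable fun k : ℕ => Real.exp (-(k * 1)) * (k + 1 : ℕ) := by
    have h1 := Real.summable_pow_mul_exp_neg_nat_mul 1 one_pos
    have h2 := Real.summable_pow_mul_exp_neg_nat_mul 0 one_pos
    refine (h1.add h2).congr fun k => ?_
    push_cast
    ring_nf
  refine ⟨|D| + (∑' k : ℕ, Real.exp (-(k * 1)) * (k + 1 : ℕ)) * C, ?_⟩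
  filter_upwards [hD, eventually_ge_atTop u₀, eventually_ge_atTop 1] with r hr hru hr1
  obtain ⟨hr0, hp, hDr⟩ := hr
  have hK : ∀ K : ℕ, ∫ s in Ioi 0, H s ^ (1 + 1 / r) ≤
      D + (∑' k : ℕ, Real.exp (-(k * 1)) * (k + 1 : ℕ)) * (C * r) +
        Real.exp (-(K / 2)) * ∫ s in Ioi 0, H s ^ (1 + 1 / (2 * r)) := fun K => by
    have h1 := (hH.rpow_sum_bounds hr0 one_pos hp K).2
    have h2 := hH.rpow_tail_le (u := K * 1 * r) hr0 hp
    have h3 : ∑ k ∈ Finset.range K, Real.exp (-(k * 1)) *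
        ((∫ s in superLevel H (Real.exp (-((k + 1 : ℕ) * 1 * r))), H s) -
          ∫ s in superLevel H (Real.exp (-(k * 1 * r))), H s) ≤
        (∑' k : ℕ, Real.exp (-(k * 1)) * (k + 1 : ℕ)) * (C * r) := by
      refine le_trans ?_ (mul_le_mul_of_nonneg_right
        (hsum.sum_le_tsum (Finset.range K) fun k _ => by positivity) (by positivity))
      rw [Finset.sum_mul]
      refine Finset.sum_le_sum fun k _ => ?_
      rw [mul_assoc (Real.exp _) ((k + 1 : ℕ) : ℝ)]
      refine mul_le_mul_of_nonneg_left ?_ (Real.exp_pos _).le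
      -- Since (k + 1)r ≥ r ≥ u₀, one threshold for r serves all k.
      have h4 := hu ((k + 1 : ℕ) * 1 * r) (by push_cast; nlinarith [k.cast_nonneg (α := ℝ)])
      rw [Real.log_exp, one_div, ← Real.exp_neg] at h4
      have h5 := hH.setIntegral_nonneg (superLevel_subset_Ioi (l := Real.exp (-(k * 1 * r))))
        (hH.measurableSet_superLevel _)
      linarith
    have h6 : (K * 1 * r) / (2 * r) = (K / 2 : ℝ) := by field_simp
    rw [h6] at h2
    linarith
  have hlim : Tendsto (fun K : ℕ => D + (∑' k : ℕ, Real.exp (-(k * 1)) * (k + 1 : ℕ)) * (C * r) +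
      Real.exp (-(K / 2)) * ∫ s in Ioi 0, H s ^ (1 + 1 / (2 * r))) atTop
      (𝓝 (D + (∑' k : ℕ, Real.exp (-(k * 1)) * (k + 1 : ℕ)) * (C * r) + 0 *
        ∫ s in Ioi 0, H s ^ (1 + 1 / (2 * r)))) := by
    refine tendsto_const_nhds.add (Tendsto.mul_const _ ?_)
    exact Real.tendsto_exp_neg_atTop_nhds_zero.comp
      (tendsto_natCast_atTop_atTop.atTop_div_const two_pos)
  have hfin := ge_of_tendsto' hlim hK
  have hDr' : D ≤ |D| * r := (le_abs_self D).trans (le_mul_of_one_le_right (abs_nonneg D) hr1)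
  linarith

theorem aemeasurable_rpow_average (hH : IsRearrangement H p₀) :
    AEMeasurable (fun t => 1 / Real.log t * ∫ s in Ioi 0, H s ^ (1 + 1 / Real.log t))
      halfLine := by
  have hae : AEMeasurable H halfLine :=
    aemeasurable_restrict_of_antitoneOn measurableSet_Ioi hH.antitoneOn
  have hm := hae.measurable_mk
  have h1 : (fun t => ∫ s in Ioi 0, H s ^ (1 + 1 / Real.log t)) =
      fun t => ∫ s in Ioi 0, hae.mk H s ^ (1 + 1 / Real.log t) := by
    funext t
    refine integral_congr_ae ?_
    filter_upwards [hae.ae_eq_mk] with s hs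
    rw [hs]
  have h2 : Measurable fun t => ∫ s in Ioi 0, hae.mk H s ^ (1 + 1 / Real.log t) := by
    refine (StronglyMeasurable.integral_prod_right
      (f := fun t s => hae.mk H s ^ (1 + 1 / Real.log t)) ?_).measurable
    refine Measurable.stronglyMeasurable ?_
    exact (hm.comp measurable_snd).pow (by fun_prop)
  rw [← h1] at h2
  exact ((by fun_prop : Measurable fun t => 1 / Real.log t).mul h2).aemeasurable

/-! ### Generalized limits of the shell sums. -/

theorem hasOmegaLim_superLevel_exp (hω : IsBanachLimit ω)
    (hP : ∀ α : ℝ, 1 < α → IsPowerInvariant ω α)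
    (hL : HasOmegaLim ω (fun t => 1 / Real.log t * ∫ s in superLevel H (1 / t), H s) L)
    {a : ℝ} (ha : 0 ≤ a) :
    HasOmegaLim ω (fun t => 1 / Real.log t *
      ∫ s in superLevel H (Real.exp (-(a * Real.log t))), H s) (a * L) := by
  rcases ha.eq_or_lt with rfl | ha
  · simp only [zero_mul, neg_zero, Real.exp_zero]
    exact hasOmegaLim_of_tendsto hω (by fun_prop) (tendsto_const_div_log _)
  · refine (hasOmegaLim_rpow hP hL ha).congr ?_
    filter_upwards [eventually_gt_atTop 0] with t ht
    rw [Real.exp_neg, mul_comm a, ← Real.rpow_def_of_pos ht, one_div (t ^ a)]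

theorem tendsto_sum_exp {d : ℝ} (hd : 0 < d) :
    Tendsto (fun K : ℕ => ∑ k ∈ Finset.range K, Real.exp (-(k * d))) atTop
      (𝓝 (1 - Real.exp (-d))⁻¹) := by
  have h := (hasSum_geometric_of_lt_one (Real.exp_pos (-d)).le
    (Real.exp_lt_one_iff.mpr (neg_lt_zero.mpr hd))).tendsto_sum_nat
  refine h.congr fun K => Finset.sum_congr rfl fun k _ => ?_
  rw [← Real.exp_nat_mul, mul_neg]

theorem omegaLim_rpow_bounds (hH : IsRearrangement H p₀) (hω : IsBanachLimit ω)
    (hP : ∀ α : ℝ, 1 < α → IsPowerInvariant ω α) {A : ℝ}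
    (hL : HasOmegaLim ω (fun t => 1 / Real.log t * ∫ s in superLevel H (1 / t), H s) L)
    (hA : HasOmegaLim ω
      (fun t => 1 / Real.log t * ∫ s in Ioi 0, H s ^ (1 + 1 / Real.log t)) A)
    {d : ℝ} (hd : 0 < d) :
    Real.exp (-d) * (1 - Real.exp (-d))⁻¹ * (d * L) ≤ A ∧
      A ≤ (1 - Real.exp (-d))⁻¹ * (d * L) := by
  obtain ⟨D, hD⟩ := hH.rpow_head_le
  have hDt := Real.tendsto_log_atTop.eventually hD
  have hlvl : ∀ k : ℕ, HasOmegaLim ω (fun t => 1 / Real.log t *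
      ((∫ s in superLevel H (Real.exp (-((k + 1 : ℕ) * d * Real.log t))), H s) -
        ∫ s in superLevel H (Real.exp (-(k * d * Real.log t))), H s)) (d * L) := fun k => by
    have h1 := hasOmegaLim_superLevel_exp hω hP hL (a := (k + 1 : ℕ) * d) (by positivity)
    have h2 := hasOmegaLim_superLevel_exp hω hP hL (a := k * d) (by positivity)
    convert h1.sub h2 using 1
    · funext t
      ring
    · push_cast
      ring
  have hsum : ∀ (w : ℕ → ℝ) (K : ℕ), HasOmegaLim ω (fun t => 1 / Real.log t *
      ∑ k ∈ Finset.range K, w k *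
      ((∫ s in superLevel H (Real.exp (-((k + 1 : ℕ) * d * Real.log t))), H s) -
        ∫ s in superLevel H (Real.exp (-(k * d * Real.log t))), H s))
      ((∑ k ∈ Finset.range K, w k) * (d * L)) := fun w K => by
    convert HasOmegaLim.sum (fun k => (hlvl k).const_mul (w k)) K using 1
    · funext t
      rw [Finset.mul_sum]
      exact Finset.sum_congr rfl fun k _ => by ring
    · rw [Finset.sum_mul]
  -- Since 2 log t = log(t²), power invariance with exponent 2 expresses the tail through A itself.
  have hA2 : HasOmegaLim ω (fun t => 1 / Real.log t *
      ∫ s in Ioi 0, H s ^ (1 + 1 / (2 * Real.log t))) (2 * A) := by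
    refine (hasOmegaLim_rpow hP (J := fun t => ∫ s in Ioi 0, H s ^ (1 + 1 / Real.log t))
      hA two_pos).congr ?_
    filter_upwards [eventually_gt_atTop 0] with t ht
    rw [Real.log_rpow ht]
  have hlow : ∀ K : ℕ, (∑ k ∈ Finset.range K, Real.exp (-((k + 1 : ℕ) * d))) * (d * L) ≤ A :=
    fun K => by
    refine (hsum _ K).mono hω hA ?_
    filter_upwards [hDt] with t ⟨hr, hp, _⟩
    refine mul_le_mul_of_nonneg_left ?_ (one_div_pos.mpr hr).le
    have h1 := (hH.rpow_sum_bounds hr hd hp K).1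
    have h2 := hH.setIntegral_rpow_mono (one_lt_exponent hr) hp Subset.rfl measurableSet_Ioi
      (superLevel_subset_Ioi (H := H) (l := Real.exp (-(K * d * Real.log t))))
    have h3 := hH.setIntegral_rpow_nonneg (superLevel_subset_Ioi (l := 1))
      (hH.measurableSet_superLevel 1) (1 + 1 / Real.log t)
    linarith
  have hup : ∀ K : ℕ, A ≤ (∑ k ∈ Finset.range K, Real.exp (-(k * d))) * (d * L) +
      Real.exp (-(K * (d / 2))) * (2 * A) := fun K => by
    have h0 := ((hasOmegaLim_of_tendsto hω (by fun_prop) (tendsto_const_div_log D)).add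
      (hsum (fun k => Real.exp (-(k * d))) K)).add
      (hA2.const_mul (Real.exp (-(K * (d / 2)))))
    rw [zero_add] at h0
    refine hA.mono hω h0 ?_
    filter_upwards [hDt] with t ⟨hr, hp, hDr⟩
    have h1 := (hH.rpow_sum_bounds hr hd hp K).2
    have h2 := hH.rpow_tail_le (u := K * d * Real.log t) hr hp
    have h3 : K * d * Real.log t / (2 * Real.log t) = K * (d / 2) := by field_simp
    rw [h3] at h2
    rw [mul_left_comm (Real.exp _), ← mul_add, ← mul_add]
    refine mul_le_mul_of_nonneg_left ?_ (one_div_pos.mpr hr).le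
    linarith
  constructor
  · refine le_of_tendsto' (((tendsto_sum_exp hd).const_mul (Real.exp (-d))).mul_const (d * L))
      fun K => ?_
    refine le_trans (le_of_eq ?_) (hlow K)
    rw [Finset.mul_sum]
    congr 1
    refine Finset.sum_congr rfl fun k _ => ?_
    rw [← Real.exp_add]
    push_cast
    ring_nf
  · have h1 : Tendsto (fun K : ℕ => Real.exp (-(K * (d / 2)))) atTop (𝓝 0) :=
      Real.tendsto_exp_neg_atTop_nhds_zero.comp
        (tendsto_natCast_atTop_atTop.atTop_mul_const (half_pos hd))
    have h2 := ((tendsto_sum_exp hd).mul_const (d * L)).add (h1.mul_const (2 * A))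
    rw [zero_mul, add_zero] at h2
    exact ge_of_tendsto' h2 hup

/-- Abelian theorem for generalized limits: the averages of `∫ H ^ (1 + 1 / r)` and of the
integrals of `H` over its superlevel sets have the same generalized limit. -/
theorem omegaLim_rpow_eq (hH : IsRearrangement H p₀) (hω : IsBanachLimit ω)
    (hP : ∀ α : ℝ, 1 < α → IsPowerInvariant ω α) {A : ℝ}
    (hL : HasOmegaLim ω (fun t => 1 / Real.log t * ∫ s in superLevel H (1 / t), H s) L)
    (hA : HasOmegaLim ω
      (fun t => 1 / Real.log t * ∫ s in Ioi 0, H s ^ (1 + 1 / Real.log t)) A) : A = L := by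
  have hL0 : 0 ≤ L := hL.nonneg hω <| by
    filter_upwards [eventually_gt_atTop 1] with t ht
    exact mul_nonneg (one_div_pos.mpr (Real.log_pos ht)).le
      (hH.setIntegral_nonneg superLevel_subset_Ioi (hH.measurableSet_superLevel _))
  have hbd : ∀ d : ℝ, 0 < d → Real.exp (-d) * L ≤ A ∧ A ≤ Real.exp d * L := fun d hd => by
    obtain ⟨h1, h2⟩ := hH.omegaLim_rpow_bounds hω hP hL hA hd
    have hpos : 0 < 1 - Real.exp (-d) := by
      have := Real.exp_lt_one_iff.mpr (neg_lt_zero.mpr hd)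
      -- From e^{-d} > 0 and e^x ≥ 1 + x at x = ±d one gets d e^{-d} ≤ 1 - e^{-d} ≤ d, so d/(1 -
      -- e^{-d}) lies between 1 and e^d.
      linarith
    have h3 : 1 - Real.exp (-d) ≤ d := by linarith [Real.add_one_le_exp (-d)]
    have h4 : d * Real.exp (-d) ≤ 1 - Real.exp (-d) := by
      have h5 : Real.exp d * Real.exp (-d) = 1 := by rw [← Real.exp_add]; simp
      have h6 := mul_le_mul_of_nonneg_right (Real.add_one_le_exp d) (Real.exp_pos (-d)).le
      linarith
    constructor
    · refine le_trans ?_ h1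
      rw [mul_assoc, ← mul_assoc _ d, ← div_eq_inv_mul]
      have : 1 ≤ d / (1 - Real.exp (-d)) := (one_le_div hpos).mpr h3
      exact mul_le_mul_of_nonneg_left (le_mul_of_one_le_left hL0 this) (Real.exp_pos _).le
    · refine h2.trans ?_
      rw [← mul_assoc, ← div_eq_inv_mul]
      refine mul_le_mul_of_nonneg_right ?_ hL0
      rw [div_le_iff₀ hpos]
      calc d = Real.exp d * (d * Real.exp (-d)) := by
            rw [mul_left_comm, ← Real.exp_add]; simp
        _ ≤ _ := mul_le_mul_of_nonneg_left h4 (Real.exp_pos d).le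
  have hup : Tendsto (fun d => Real.exp d * L) (𝓝[>] 0) (𝓝 L) := by
    have h : Continuous fun d => Real.exp d * L := by fun_prop
    simpa using (h.tendsto 0).mono_left nhdsWithin_le_nhds
  have hlow : Tendsto (fun d => Real.exp (-d) * L) (𝓝[>] 0) (𝓝 L) := by
    have h : Continuous fun d => Real.exp (-d) * L := by fun_prop
    simpa using (h.tendsto 0).mono_left nhdsWithin_le_nhds
  exact le_antisymm (ge_of_tendsto hup (eventually_mem_nhdsWithin.mono fun d hd => (hbd d hd).2))
    (le_of_tendsto hlow (eventually_mem_nhdsWithin.mono fun d hd => (hbd d hd).1))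

theorem exists_common_omegaTildeLim (hH : IsRearrangement H p₀) (hω : IsBanachLimit ω)
    (hP : ∀ α : ℝ, 1 < α → IsPowerInvariant ω α) (hc : cSup H < ⊤) :
    ∃ L : ℝ,
      HasOmegaTildeLim ω (fun r => 1 / r * ∫ s in Ioi 0, H s ^ (1 + 1 / r)) L ∧
      HasOmegaLim ω (fun t => 1 / Real.log t * ∫ s in Ioc 0 t, H s) L := by
  obtain ⟨c, hc', -⟩ := EReal.lt_iff_exists_real_btwn.mp hc
  obtain ⟨L, hL, -, hM⟩ := hH.exists_common_omegaLim hω hP hc'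
  obtain ⟨C, hC⟩ := hH.exists_rpow_bound hc
  obtain ⟨A, hA⟩ := exists_hasOmegaLim (ω := ω) hH.aemeasurable_rpow_average (C := C) (by
    filter_upwards [Real.tendsto_log_atTop.eventually hC, eventually_gt_atTop 1] with t h1 ht
    have hl := Real.log_pos ht
    rw [abs_of_nonneg (mul_nonneg (one_div_pos.mpr hl).le
      (hH.setIntegral_rpow_nonneg Subset.rfl measurableSet_Ioi _)), one_div,
      inv_mul_le_iff₀ hl, mul_comm, ← one_div]
    exact h1)
  obtain rfl := hH.omegaLim_rpow_eq hω hP hM hA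
  exact ⟨A, hA, hL⟩

/-! ### Finiteness of c_H from either side of (c), and the conclusion. -/

theorem cSup_lt_top_of_hasOmegaLim (hH : IsRearrangement H p₀)
    (hL : HasOmegaLim ω (fun t => 1 / Real.log t * ∫ s in Ioc 0 t, H s) L) : cSup H < ⊤ := by
  obtain ⟨C, T, h⟩ := hL.exists_ae_abs_le
  refine hH.cSup_lt_top (abs_nonneg C) (T := max T 1) ?_
  filter_upwards [h] with t ht hlt
  have hl : 0 < Real.log t := Real.log_pos ((le_max_right _ _).trans_lt hlt)
  have h1 := (le_abs_self _).trans ((ht ((le_max_left _ _).trans_lt hlt)).trans (le_abs_self C))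
  rwa [one_div, inv_mul_le_iff₀ hl, mul_comm] at h1

theorem cSup_lt_top_of_hasOmegaTildeLim (hH : IsRearrangement H p₀)
    (hL : HasOmegaTildeLim ω (fun r => 1 / r * ∫ s in Ioi 0, H s ^ (1 + 1 / r)) L) :
    cSup H < ⊤ := by
  obtain ⟨C, T, h⟩ := HasOmegaLim.exists_ae_abs_le hL
  obtain ⟨D, hD⟩ := hH.rpow_head_le
  obtain ⟨S, hS⟩ := eventually_atTop.mp ((Real.tendsto_log_atTop.eventually hD).and
    (Real.tendsto_log_atTop.eventually_ge_atTop 1))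
  refine hH.cSup_lt_top (C := Real.exp 1 * |C| + 1) (by positivity) (T := max T (max S 1)) ?_
  filter_upwards [h] with t ht hlt
  rw [max_lt_iff, max_lt_iff] at hlt
  obtain ⟨⟨hr, hp, -⟩, hl1⟩ := hS t hlt.2.1.le
  have h1 := (le_abs_self _).trans ((ht hlt.1).trans (le_abs_self C))
  rw [one_div, inv_mul_le_iff₀ hr, ← one_div] at h1
  refine (hH.setIntegral_Ioc_le_rpow hlt.2.2 hp).trans ?_
  have h2 := mul_le_mul_of_nonneg_left h1 (Real.exp_pos 1).le
  linarith

end IsRearrangement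

theorem proposition8
    (ω : LInfty →L[ℝ] ℝ) (hω : IsBanachLimit ω)
    (hD : IsDilationInvariant ω 2) (hP : ∀ α : ℝ, 1 < α → IsPowerInvariant ω α)
    (H : ℝ → ℝ) (hmono : AntitoneOn H (Ioi 0)) (hne : ∃ t : ℝ, 0 < t ∧ H t ≠ 0)
    (p₀ : ℝ) (hp₀ : 1 < p₀)
    (hLp : ∀ p : ℝ, 1 < p → p < p₀ → MemLp H (ENNReal.ofReal p) halfLine) :
    -- the quantities involved are well defined
    (∀ t : ℝ, 0 < t → IntegrableOn H (Ioc 0 t)) ∧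
    (∀ l : ℝ, 0 < l → BddAbove {t : ℝ | 0 < t ∧ l < H t}) ∧
    -- (a)
    (∀ c : ℝ, cSup H < (c : EReal) →
      ∃ t₀ : ℝ, 0 < t₀ ∧ ∀ t : ℝ, t₀ ≤ t → distFun H (1 / t) ≤ c * t * Real.log t) ∧
    -- (b)
    (∀ c : ℝ, cSup H < (c : EReal) → ∃ L : ℝ,
      HasOmegaLim ω (fun t => 1 / Real.log t * ∫ s in Ioc 0 t, H s) L ∧
      HasOmegaLim ω (fun t => 1 / Real.log t * ∫ s in Ioc 0 (c * t * Real.log t), H s) L ∧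
      HasOmegaLim ω (fun t => 1 / Real.log t * ∫ s in Ioc 0 (distFun H (1 / t)), H s) L) ∧
    -- (c); the two sides are defined simultaneously, and then they are equal
    (cSup H < ⊤ → ∃ L : ℝ,
      HasOmegaTildeLim ω (fun r => 1 / r * ∫ s in Ioi 0, H s ^ (1 + 1 / r)) L ∧
      HasOmegaLim ω (fun t => 1 / Real.log t * ∫ s in Ioc 0 t, H s) L) ∧
    (∀ L : ℝ,
      HasOmegaTildeLim ω (fun r => 1 / r * ∫ s in Ioi 0, H s ^ (1 + 1 / r)) L ↔
      HasOmegaLim ω (fun t => 1 / Real.log t * ∫ s in Ioc 0 t, H s) L) := by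
  have hH : IsRearrangement H p₀ := ⟨hmono, hp₀, hLp⟩
  refine ⟨fun t _ => hH.integrableOn_Ioc t, fun l hl => hH.bddAbove_superLevel hl,
    fun c hc => ?_, fun c hc => ?_, hH.exists_common_omegaTildeLim hω hP, fun L => ⟨fun h => ?_,
    fun h => ?_⟩⟩
  · obtain ⟨T, hT⟩ := eventually_atTop.mp (hH.eventually_distFun_le hc)
    exact ⟨max T 1, by positivity, fun t ht => hT t ((le_max_left _ _).trans ht)⟩
  · obtain ⟨L, h1, h2, h3⟩ := hH.exists_common_omegaLim hω hP hc
    refine ⟨L, h1, h2, h3.congr ?_⟩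
    filter_upwards [eventually_gt_atTop 0] with t ht
    rw [hH.setIntegral_distFun (one_div_pos.mpr ht)]
  -- Definedness of one side gives c_H < ∞, hence a common value for both, which uniqueness
  -- identifies with L.
  · obtain ⟨L', h1, h2⟩ :=
      hH.exists_common_omegaTildeLim hω hP (hH.cSup_lt_top_of_hasOmegaTildeLim h)
    rwa [HasOmegaLim.unique hω h h1]
  · obtain ⟨L', h1, h2⟩ :=
      hH.exists_common_omegaTildeLim hω hP (hH.cSup_lt_top_of_hasOmegaLim h)
    rwa [h.unique hω h2]
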